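/- Let $B,D\ge 1$ and $C,S,K,W,Q\ge 0$ be integers and let $N=BD$. The Stash Shuffle with these parameters takes an array of $N$ distinct items, viewed as $B$ consecutive input buckets of $D$ items each, and works as follows. *Random choices.* Every item independently chooses a uniformly random target among the $B$ output buckets. Independently of this and of each other, $B$ uniformly random permutations of $CB+K$ slots are chosen, one for every output bucket. *Distribution phase.* The intermediate array consists of $B$ buckets, initially empty, and the stash consists of $B$ first-in-first-out queues, one for each output bucket, initially empty. The input buckets are processed in order. For each of them, a new chunk of capacity $C$ is opened for every output bucket $j$; items are moved from the $j$-th stash queue into the $j$-th chunk as long as the queue is nonempty and the chunk is not full. Then each of the $D$ items in order, with target $j$, is put into the $j$-th chunk if this is not full; otherwise it is put into the $j$-th stash queue if the stash contains fewer than $S$ items in total; otherwise the shuffle fails. Finally the chunks are padded with dummies to exactly $C$ slots and appended to the corresponding intermediate buckets. After the last input bucket, up to $K$ items of each stash queue are appended, padded with dummies to exactly $K$ slots, to the corresponding intermediate bucket, and the shuffle fails if the stash is then nonempty. *Compression phase.* Let $L=\min(W,B)$. To read an intermediate bucket means to permute its $CB+K$ slots by its random permutation, to discard the dummies, and to append the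 remaining items in order to a queue. To write an output bucket means to move $D$ items from the front of the queue to the end of the output array; the shuffle fails if there are fewer than $D$ items in the queue. The first $L$ intermediate buckets are read; then, in each of the next $B-L$ iterations, the next intermediate bucket is read and one output bucket is written; then the last $L$ output buckets are written. The shuffle fails if more than $WD+Q$ items are in the queue after one of the first $L$ reads or at the end of one of the $B-L$ iterations. (So, if $Y_i$ is the number of items in the first $i$ intermediate buckets, the compression phase fails for $1\le W\le B$ exactly if $0\le Y_i-D(i-W)\le WD+Q$ is violated for some $W\le i\le B$.) The output is the output array, or the symbol $\bot$ if the shuffle fails. **Theorem.** Put $t=CB/D-1$ and assume that $K\ge S/B>2C$, $W\le B$ and $$e^{t}<1+(tC-\ln 2)\,\frac{B}{D}.$$ Then, for every input array of $N$ distinct items, the statistical (total variation) distance between the distribution of the output of the Stash Shuffle and the uniform distribution on the $N!$ arrangements of the items is at most $$B^2\exp\left\{(CB/D-1)(2C-S/B)\right\}+B\left\{\exp\left(-\frac{2(DW)^2}{N}\right)+\exp\left(-\frac{2Q^2}{N}\right)\right\}.$$ -/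

import Mathlib

namespace StashShuffle

/-- Parameters: `B` buckets of `D` items each, quota `C` per (input bucket, output bucket) pair,
total stash capacity `S`, `K` extra slots per output bucket for the final stash drain,
window size `W`, queue slack `Q`. -/
structure Params where
  B : ℕ
  D : ℕ
  C : ℕ
  S : ℕ
  K : ℕ
  W : ℕ
  Q : ℕ

/-- The number of items, `N = B * D`. -/
abbrev Params.N (P : Params) : ℕ := P.B * P.D

/-- Number of slots of an intermediate bucket: `C` per input bucket and `K` for the drain. -/
abbrev Params.slots (P : Params) : ℕ := P.C * P.B + P.K

/-- `dataIdx b i = b * D + i`: the position of the `i`-th item of the `b`-th input bucket. -/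
def Params.dataIdx (P : Params) (b : Fin P.B) (i : Fin P.D) : Fin P.N :=
  finProdFinEquiv (b, i)

/-- The contents `output` (of the chunks to be written, one per output bucket) and `stash`
(one FIFO queue per output bucket) of private memory during the distribution of one bucket. -/
structure ChunkState (P : Params) (α : Type*) where
  output : Fin P.B → List α
  stash : Fin P.B → List α

/-- State between two steps of the distribution phase: the intermediate array, in which `none` is
a dummy, and the stash. -/
structure DistState (P : Params) (α : Type*) where
  mid : Fin P.B → List (Option α)
  stash : Fin P.B → List α

/-- A chunk padded with dummies up to `n` slots. -/
def pad {α : Type*} (n : ℕ) (l : List α) : List (Option α) :=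
  l.map some ++ List.replicate (n - l.length) none

section Algorithm

variable {α : Type*} (P : Params)

/-- Move stashed items into empty chunks of size `n`, while there is room and there are items. -/
def unstash (n : ℕ) (stash : Fin P.B → List α) : ChunkState P α where
  output := fun j => (stash j).take n
  stash := fun j => (stash j).drop n

/-- Put one item with target `j` in its chunk if that has fewer than `C` items, otherwise in
the stash if that holds fewer than `S` items in total, and otherwise fail. -/
def placeItem (s : ChunkState P α) (j : Fin P.B) (x : α) : Option (ChunkState P α) :=
  if (s.output j).length < P.C then
    some { s with output := Function.update s.output j (s.output j ++ [x]) }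
  else if ∑ k, (s.stash k).length < P.S then
    some { s with stash := Function.update s.stash j (s.stash j ++ [x]) }
  else none

/-- Distribute one input bucket with the given items and targets; every output bucket of the
intermediate array receives a chunk of exactly `C` slots. -/
def distributeBucket (targets : Fin P.D → Fin P.B) (items : Fin P.D → α) (s : DistState P α) :
    Option (DistState P α) :=
  ((List.finRange P.D).foldlM (fun c i => placeItem P c (targets i) (items i))
      (unstash P P.C s.stash)).map fun c =>
    { mid := fun j => s.mid j ++ pad P.C (c.output j)
      stash := c.stash }

/-- The final drain of the stash, `K` slots per output bucket; it fails if items are left. -/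
def drainStash (s : DistState P α) : Option (Fin P.B → List (Option α)) :=
  let c := unstash P P.K s.stash
  if ∀ j, c.stash j = [] then some fun j => s.mid j ++ pad P.K (c.output j) else none

/-- The distribution phase: all input buckets in turn, then the drain of the stash. -/
def distribute (targets : Fin P.B → Fin P.D → Fin P.B) (input : Fin P.N → α) :
    Option (Fin P.B → List (Option α)) :=
  ((List.finRange P.B).foldlM
      (fun s b => distributeBucket P (targets b) (fun i => input (P.dataIdx b i)) s)
      { mid := fun _ => [], stash := fun _ => [] }).bind (drainStash P)

/-- Permute the slots of an intermediate bucket (dummies included) by `σ`, then throw away the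
dummies. Intermediate buckets always have exactly `P.slots` slots. -/
def shuffleBucket (σ : Equiv.Perm (Fin P.slots)) (bucket : List (Option α)) : List α :=
  (List.ofFn fun i => bucket.getD (σ i) none).reduceOption

/-- State of the compression phase: the queue in private memory and the output written so far. -/
structure CompState (α : Type*) where
  queue : List α
  out : List α

/-- Enqueue the real items of an intermediate bucket. -/
def importBucket (bucket : List α) (s : CompState α) : CompState α :=
  { s with queue := s.queue ++ bucket }

/-- Write `D` items from the front of the queue as the next output bucket; fail on underflow. -/
def drainQueue (s : CompState α) : Option (CompState α) :=
  if s.queue.length < P.D then none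
  else some { queue := s.queue.drop P.D, out := s.out ++ s.queue.take P.D }

/-- Fail if more than `W * D + Q` items are kept in the queue. -/
def checkQueue (s : CompState α) : Option (CompState α) :=
  if s.queue.length ≤ P.W * P.D + P.Q then some s else none

/-- The compression phase, on intermediate buckets already shuffled and freed of dummies, with
effective window `L = min W B`. The first `L` buckets are read into the queue. Then, in each of
the next `B - L` iterations, the next bucket is read and one output bucket is written. Finally
the last `L` output buckets are written. Between iterations at most `W * D + Q` items may be
kept. So after `i ≥ L` buckets with `Y i` items in all have been read, `i - L` output buckets
have been written, and failure means that `0 ≤ Y i - D * (i - L) ≤ W * D + Q` is violated. -/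
def compress (bucket : Fin P.B → List α) : Option (List α) :=
  let L := min P.W P.B
  let idx := List.finRange P.B
  do
    let s₁ ← (idx.take L).foldlM (fun s b => checkQueue P (importBucket (bucket b) s))
      { queue := [], out := [] }
    let s₂ ← (idx.drop L).foldlM
      (fun s b => (drainQueue P (importBucket (bucket b) s)).bind (checkQueue P)) s₁
    let s₃ ← (idx.drop (P.B - L)).foldlM (fun s _ => drainQueue P s) s₂
    return s₃.out

/-- The random choices: a target bucket for every item of every input bucket, and a permutation of
the slots of every intermediate bucket. -/
abbrev Coins : Type :=
  (Fin P.B → Fin P.D → Fin P.B) × (Fin P.B → Equiv.Perm (Fin P.slots))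

instance : Nonempty (Coins P) :=
  ⟨(fun b _ => b, fun _ => 1)⟩

/-- The Stash Shuffle as a function of its random choices and its input array. The value is the
output array, or `none` if the shuffle fails. -/
def run (ω : Coins P) (input : Fin P.N → α) : Option (List α) :=
  (distribute P ω.1 input).bind fun mid => compress P fun j => shuffleBucket P (ω.2 j) (mid j)

/-- The distribution of the output of the Stash Shuffle; all random choices are uniform and
independent. -/
noncomputable def outputDist (input : Fin P.N → α) : PMF (Option (List α)) :=
  (PMF.uniformOfFintype (Coins P)).map fun ω => run P ω input

end Algorithm

/-- The uniform distribution on the arrangements of the items `0, …, n - 1` in an array (an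
ideal shuffle, which never fails). -/
noncomputable def uniformDist (n : ℕ) : PMF (Option (List (Fin n))) :=
  (PMF.uniformOfFintype (Equiv.Perm (Fin n))).map fun π => some (List.ofFn fun i => π i)

/-- Statistical (total variation) distance: the supremum over all events `A` of
`|p A - q A|`. -/
noncomputable def statDist {β : Type*} (p q : PMF β) : ℝ :=
  ⨆ A : Set β, |(p.toOuterMeasure A).toReal - (q.toOuterMeasure A).toReal|

end StashShuffle

/-!
An output `l` other than `⊥` is the concatenation of `B` blocks, the `j`-th of which is a
permutation of the items with target `j`; so `l` together with the numbers `n j` of items per target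
determines all targets. For fixed targets, at most a fraction `1 / ∏ j, (n j)!` of the permutations
of the slots leads to `l`. Summing over the possible `n`, the multinomial theorem
`∑ n, N! / ∏ j, (n j)! = B ^ N` shows that `l` has probability at most `1 / N!`. Hence the
distance to the uniform distribution is at most the failure probability.

The length of a stash queue after an input bucket follows Lindley's recursion
`q (k + 1) = (q k + x k - C)⁺` as long as the stash has room. The condition on `t` says that
`exp (t * (x k - C))` has mean at most `1 / 2`, so by `exp (t * q⁺) ≤ 1 + exp (t * q)` the mean of
`exp (t * q k)` never exceeds `2`, and Markov's inequality bounds the probability that some stash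
queue reaches `S / B`. The queue of the compression phase holds the items with a target among the
first buckets, less those written; Hoeffding's inequality bounds both of its tails.
-/

namespace StashShuffle

open scoped Finset Nat

section Folds

variable {σ β : Type*} {f : σ → β → Option σ} {l : List β} {Inv : ℕ → σ → Prop} {s₀ : σ}

theorem invariant_of_foldlM_eq_some {s₁ : σ}
    (step : ∀ k (hk : k < l.length) s s', Inv k s → f s l[k] = some s' → Inv (k + 1) s')
    (base : Inv 0 s₀) (h : l.foldlM f s₀ = some s₁) : Inv l.length s₁ := by
  induction l generalizing Inv s₀ with
  | nil => exact Option.some.inj h ▸ base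
  | cons a l ih =>
    rw [List.foldlM_cons] at h
    obtain ⟨s, hs, h⟩ := Option.bind_eq_some_iff.1 h
    exact ih (Inv := fun k => Inv (k + 1))
      (fun k hk => step (k + 1) (Nat.succ_lt_succ hk)) (step 0 (by simp) _ _ base hs) h

theorem exists_foldlM_eq_some
    (step : ∀ k (hk : k < l.length) s, Inv k s → ∃ s', f s l[k] = some s' ∧ Inv (k + 1) s')
    (base : Inv 0 s₀) : ∃ s₁, l.foldlM f s₀ = some s₁ ∧ Inv l.length s₁ := by
  induction l generalizing Inv s₀ with
  | nil => exact ⟨s₀, rfl, base⟩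
  | cons a l ih =>
    obtain ⟨s, hs, hInv⟩ := step 0 (by simp) _ base
    obtain ⟨s₁, h, hInv₁⟩ := ih (Inv := fun k => Inv (k + 1))
      (fun k hk => step (k + 1) (Nat.succ_lt_succ hk)) hInv
    exact ⟨s₁, by rw [List.foldlM_cons]; exact Option.bind_eq_some_iff.2 ⟨s, hs, h⟩, hInv₁⟩

end Folds

section ConcatFirst

variable {α : Type*} {n : ℕ}

/-- The concatenation of the first `k` lists of a finite family: what has been received after
`k` steps. -/
def concatFirst (f : Fin n → List α) (k : ℕ) : List α :=
  ((List.finRange n).take k).flatMap f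

theorem concatFirst_zero (f : Fin n → List α) : concatFirst f 0 = [] := rfl

theorem concatFirst_succ (f : Fin n → List α) {k : ℕ} (hk : k < n) :
    concatFirst f (k + 1) = concatFirst f k ++ f ⟨k, hk⟩ := by
  simp [concatFirst, List.take_add_one, hk]

theorem concatFirst_self (f : Fin n → List α) : concatFirst f n = (List.ofFn f).flatten := by
  rw [concatFirst, List.take_of_length_le (by simp), List.ofFn_eq_map, List.flatMap_def]

theorem coe_take_finRange (n k : ℕ) :
    ((List.finRange n).take k : Multiset (Fin n)) =
      (Finset.univ.filter fun i : Fin n => i.val < k).val := by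
  refine (Multiset.Nodup.ext ?_ (Finset.nodup _)).2 fun i => ?_
  · exact (List.nodup_finRange n).sublist (List.take_sublist k _)
  · simp only [Multiset.mem_coe, List.mem_take_iff_getElem, List.length_finRange,
      List.getElem_finRange, Fin.cast_mk, Fin.ext_iff, Finset.mem_val,
      Finset.mem_filter, Finset.mem_univ, true_and]
    exact ⟨by rintro ⟨m, hm, hi⟩; omega, fun hi => ⟨i, by omega, rfl⟩⟩

theorem coe_concatFirst (f : Fin n → List α) (k : ℕ) :
    (concatFirst f k : Multiset α) = ∑ i with i.val < k, (f i : Multiset α) := by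
  rw [concatFirst, ← Multiset.coe_bind, coe_take_finRange]
  rfl

theorem coe_concatFirst_self (f : Fin n → List α) :
    (concatFirst f n : Multiset α) = ∑ i, (f i : Multiset α) := by
  simp [coe_concatFirst]

theorem mem_concatFirst_self {f : Fin n → List α} {x : α} :
    x ∈ concatFirst f n ↔ ∃ i, x ∈ f i := by
  simp [concatFirst_self]

theorem length_concatFirst (f : Fin n → List α) (k : ℕ) :
    (concatFirst f k).length = ∑ i with i.val < k, (f i).length := by
  simpa using congrArg Multiset.card (coe_concatFirst f k)

theorem length_concatFirst_le (f : Fin n → List α) (k : ℕ) :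
    (concatFirst f k).length ≤ (concatFirst f n).length := by
  rw [concatFirst, concatFirst, List.take_of_length_le (i := n) (by simp)]
  exact ((List.take_sublist k _).flatMap f).length_le

end ConcatFirst

section Arrivals

variable {α κ : Type*} [DecidableEq κ] {n : ℕ}

/-- The items of an input bucket `x` with target `j`, in order, among the first `k` items. -/
def itemsFor (τ : Fin n → κ) (x : Fin n → α) (j : κ) (k : ℕ) : List α :=
  concatFirst (fun i => if τ i = j then [x i] else []) k

theorem length_itemsFor_self (τ : Fin n → κ) (x : Fin n → α) (j : κ) :
    (itemsFor τ x j n).length = #{i | τ i = j} := by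
  simp [itemsFor, length_concatFirst, apply_ite List.length]

theorem sum_itemsFor_self [Fintype κ] (τ : Fin n → κ) (x : Fin n → α) :
    ∑ j, (itemsFor τ x j n : Multiset α) = ∑ i, {x i} := by
  simp only [itemsFor, coe_concatFirst_self]
  rw [Finset.sum_comm]
  simp [apply_ite ((↑) : List α → Multiset α)]

variable {P : Params}

/-- The items with target `j` in the first `k` input buckets, in order. -/
def arrivals (T : Fin P.B → Fin P.D → Fin P.B) (input : Fin P.N → α) (j : Fin P.B) (k : ℕ) :
    List α :=
  concatFirst (fun b => itemsFor (T b) (fun i => input (P.dataIdx b i)) j P.D) k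

theorem arrivals_succ (T : Fin P.B → Fin P.D → Fin P.B) (input : Fin P.N → α) (j : Fin P.B)
    {k : ℕ} (hk : k < P.B) :
    arrivals T input j (k + 1) = arrivals T input j k ++
      itemsFor (T ⟨k, hk⟩) (fun i => input (P.dataIdx ⟨k, hk⟩ i)) j P.D :=
  concatFirst_succ _ hk

theorem sum_arrivals_self (T : Fin P.B → Fin P.D → Fin P.B) (input : Fin P.N → α) :
    ∑ j, (arrivals T input j P.B : Multiset α) = ∑ i, {input i} := by
  simp only [arrivals, coe_concatFirst_self]
  rw [Finset.sum_comm]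
  simp only [sum_itemsFor_self, Params.dataIdx]
  rw [← Fintype.sum_prod_type', finProdFinEquiv.sum_comp fun i => ({input i} : Multiset α)]

end Arrivals

section Distribution

variable {α : Type*} {P : Params}

/-- The length after `k` steps of a queue that receives `x b` items in step `b` and then loses up
to `C` of them (Lindley's recursion). This is the length of a stash queue as long as the capacity
of the stash has not been reached. -/
def backlog {n : ℕ} (C : ℕ) (x : Fin n → ℕ) : ℕ → ℕ
  | 0 => 0
  | k + 1 => backlog C x k + (if hk : k < n then x ⟨k, hk⟩ else 0) - C

theorem backlog_succ {n C : ℕ} (x : Fin n → ℕ) {k : ℕ} (hk : k < n) :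
    backlog C x (k + 1) = backlog C x k + x ⟨k, hk⟩ - C := by
  rw [backlog, dif_pos hk]

/-- No chunk is over capacity, and only items whose chunk is full are in the stash. -/
def ChunkState.Wf (c : ChunkState P α) : Prop :=
  ∀ j, (c.output j).length ≤ P.C ∧ ((c.output j).length < P.C → c.stash j = [])

/-- The chunks and the stash after `k` items with targets `τ`, starting from the stash `st`. -/
def ChunkState.Placed (c : ChunkState P α) (st : Fin P.B → List α) (τ : Fin P.D → Fin P.B)
    (x : Fin P.D → α) (k : ℕ) : Prop :=
  c.Wf ∧ ∀ j, c.output j ++ c.stash j = st j ++ itemsFor τ x j k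

theorem unstash_append (n : ℕ) (st : Fin P.B → List α) (j : Fin P.B) :
    (unstash P n st).output j ++ (unstash P n st).stash j = st j :=
  List.take_append_drop n (st j)

theorem unstash_placed (st : Fin P.B → List α) (τ : Fin P.D → Fin P.B) (x : Fin P.D → α) :
    (unstash P P.C st).Placed st τ x 0 := by
  refine ⟨fun j => ?_, fun j => by simp [unstash_append, itemsFor, concatFirst_zero]⟩
  simp only [unstash, List.length_take, List.drop_eq_nil_iff]
  omega

theorem ChunkState.Wf.of_placeItem_eq_some {c c' : ChunkState P α} (hc : c.Wf) {j : Fin P.B}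
    {x : α} (h : placeItem P c j x = some c') : c'.Wf := by
  unfold placeItem at h
  intro k
  split_ifs at h with hroom <;> obtain rfl := Option.some.inj h <;>
    rcases eq_or_ne k j with rfl | hk
  · simp only [Function.update_self, List.length_append, List.length_singleton]
    exact ⟨hroom, fun _ => (hc k).2 hroom⟩
  · simpa only [Function.update_of_ne hk] using hc k
  · exact ⟨(hc k).1, fun h => absurd h hroom⟩
  · simpa only [Function.update_of_ne hk] using hc k

theorem output_append_stash_of_placeItem_eq_some {c c' : ChunkState P α} (hc : c.Wf)
    {j : Fin P.B} {x : α} (h : placeItem P c j x = some c') (k : Fin P.B) :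
    c'.output k ++ c'.stash k = (c.output k ++ c.stash k) ++ if j = k then [x] else [] := by
  unfold placeItem at h
  split_ifs at h with hroom <;> obtain rfl := Option.some.inj h <;>
    rcases eq_or_ne k j with rfl | hk
  · simp [(hc k).2 hroom]
  · simp [Function.update_of_ne hk, hk.symm]
  · simp
  · simp [Function.update_of_ne hk, hk.symm]

theorem exists_placeItem_eq_some {c : ChunkState P α} (h : ∑ k, (c.stash k).length < P.S)
    (j : Fin P.B) (x : α) : ∃ c', placeItem P c j x = some c' := by
  unfold placeItem
  split_ifs <;> exact ⟨_, rfl⟩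

section Placed

variable {c c' : ChunkState P α} {st : Fin P.B → List α} {τ : Fin P.D → Fin P.B}
  {x : Fin P.D → α} {k : ℕ}

theorem ChunkState.Placed.succ (hc : c.Placed st τ x k) (hk : k < P.D)
    (h : placeItem P c (τ ⟨k, hk⟩) (x ⟨k, hk⟩) = some c') : c'.Placed st τ x (k + 1) := by
  refine ⟨hc.1.of_placeItem_eq_some h, fun j => ?_⟩
  rw [output_append_stash_of_placeItem_eq_some hc.1 h, hc.2, itemsFor, itemsFor,
    concatFirst_succ _ hk, List.append_assoc]

theorem ChunkState.Placed.length_stash (hc : c.Placed st τ x k) (j : Fin P.B) :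
    (c.stash j).length = (st j).length + (itemsFor τ x j k).length - P.C := by
  obtain ⟨hle, hlt⟩ := hc.1 j
  rw [← List.length_append, ← hc.2, List.length_append]
  rcases hle.lt_or_eq with h | h
  · simp [hlt h, hle]
  · omega

end Placed

theorem length_pad {n : ℕ} {l : List α} (h : l.length ≤ n) : (pad n l).length = n := by
  simp [pad, h]

theorem reduceOption_pad (n : ℕ) (l : List α) : (pad n l).reduceOption = l := by
  simp [pad, List.reduceOption, List.filterMap_map]

section DistributeBucket

variable {τ : Fin P.D → Fin P.B} {x : Fin P.D → α} {s s' : DistState P α}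

theorem length_and_append_of_distributeBucket_eq_some (h : distributeBucket P τ x s = some s')
    (j : Fin P.B) :
    (s'.mid j).length = (s.mid j).length + P.C ∧
      (s'.mid j).reduceOption ++ s'.stash j =
        ((s.mid j).reduceOption ++ s.stash j) ++ itemsFor τ x j P.D := by
  obtain ⟨c, hc, rfl⟩ := Option.map_eq_some_iff.1 h
  have placed : c.Placed s.stash τ x P.D := by
    simpa using invariant_of_foldlM_eq_some (Inv := fun k c => c.Placed s.stash τ x k)
      (fun k hk _ _ hInv hf => hInv.succ (by simpa using hk) (by simpa using hf))
      (unstash_placed s.stash τ x) hc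
  constructor
  · rw [List.length_append, length_pad (placed.1 j).1]
  · simp only [List.reduceOption_append, reduceOption_pad, List.append_assoc, placed.2]

theorem exists_distributeBucket_eq_some
    (h : ∑ j, ((s.stash j).length + #{i | τ i = j} - P.C) < P.S) :
    ∃ s', distributeBucket P τ x s = some s' ∧
      ∀ j, (s'.stash j).length = (s.stash j).length + #{i | τ i = j} - P.C := by
  have room {c : ChunkState P α} {k : ℕ} (hc : c.Placed s.stash τ x k) :
      ∑ j, (c.stash j).length < P.S := by
    refine lt_of_le_of_lt (Finset.sum_le_sum fun j _ => ?_) h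
    rw [hc.length_stash, ← length_itemsFor_self τ x]
    exact Nat.sub_le_sub_right (Nat.add_le_add_left (length_concatFirst_le _ k) _) _
  obtain ⟨c, hc, placed⟩ := exists_foldlM_eq_some (f := fun c i => placeItem P c (τ i) (x i))
    (l := List.finRange P.D) (Inv := fun k c => c.Placed s.stash τ x k)
    (fun k hk c hInv => by
      rw [List.length_finRange] at hk
      obtain ⟨c', hc'⟩ := exists_placeItem_eq_some (room hInv) (τ ⟨k, hk⟩) (x ⟨k, hk⟩)
      exact ⟨c', by simpa using hc', hInv.succ hk hc'⟩)
    (unstash_placed s.stash τ x)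
  rw [List.length_finRange] at placed
  refine ⟨_, by rw [distributeBucket, hc]; rfl, fun j => ?_⟩
  rw [placed.length_stash, length_itemsFor_self]

end DistributeBucket

section Distribute

variable {T : Fin P.B → Fin P.D → Fin P.B} {input : Fin P.N → α}

theorem length_and_reduceOption_of_distribute_eq_some {mid : Fin P.B → List (Option α)}
    (h : distribute P T input = some mid) (j : Fin P.B) :
    (mid j).length = P.slots ∧ (mid j).reduceOption = arrivals T input j P.B := by
  obtain ⟨s, hs, hdrain⟩ := Option.bind_eq_some_iff.1 h
  have hInv : (s.mid j).length = P.C * P.B ∧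
      (s.mid j).reduceOption ++ s.stash j = arrivals T input j P.B := by
    simpa using invariant_of_foldlM_eq_some
      (Inv := fun k (s : DistState P α) => (s.mid j).length = P.C * k ∧
        (s.mid j).reduceOption ++ s.stash j = arrivals T input j k)
      (fun k hk s s' hInv hf => by
        rw [List.length_finRange] at hk
        obtain ⟨hlen, happ⟩ := length_and_append_of_distributeBucket_eq_some hf j
        exact ⟨by rw [hlen, hInv.1, mul_add_one], by
          rw [happ, hInv.2, arrivals_succ T input j hk]; simp⟩)
      ⟨rfl, rfl⟩ hs
  simp only [drainStash] at hdrain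
  split_ifs at hdrain with hnil
  obtain rfl := Option.some.inj hdrain
  have hout : (unstash P P.K s.stash).output j = s.stash j := by
    simpa [hnil j] using unstash_append P.K s.stash j
  constructor
  · rw [List.length_append, hInv.1,
      length_pad (l := (unstash P P.K s.stash).output j) (List.length_take_le _ _)]
  · rw [List.reduceOption_append, reduceOption_pad, hout, hInv.2]

theorem exists_distribute_eq_some
    (hS : ∀ b : Fin P.B, ∑ j, backlog P.C (fun b => #{i | T b i = j}) (b + 1) < P.S)
    (hK : ∀ j, backlog P.C (fun b => #{i | T b i = j}) P.B ≤ P.K) :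
    ∃ mid, distribute P T input = some mid := by
  obtain ⟨s, hs, hlen⟩ := exists_foldlM_eq_some
    (f := fun s b => distributeBucket P (T b) (fun i => input (P.dataIdx b i)) s)
    (l := List.finRange P.B)
    (Inv := fun k (s : DistState P α) =>
      ∀ j, (s.stash j).length = backlog P.C (fun b => #{i | T b i = j}) k)
    (fun k hk s hInv => by
      rw [List.length_finRange] at hk
      have hSk := hS ⟨k, hk⟩
      simp only [backlog_succ _ hk, ← hInv] at hSk ⊢
      simpa using exists_distributeBucket_eq_some hSk)
    (s₀ := { mid := fun _ => [], stash := fun _ => [] }) fun j => rfl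
  rw [List.length_finRange] at hlen
  rw [distribute, hs, Option.bind_some, drainStash]
  refine ⟨_, if_pos fun j => List.drop_eq_nil_iff.2 ?_⟩
  rw [hlen j]
  exact hK j

end Distribute

end Distribution

section Compression

variable {α : Type*} {P : Params} {bucket : Fin P.B → List α} {s s' : CompState α} {r w : ℕ}

theorem exists_drainQueue_eq_some (h : P.D ≤ s.queue.length) :
    ∃ s', drainQueue P s = some s' :=
  ⟨_, if_neg h.not_gt⟩

theorem eq_of_checkQueue_eq_some (h : checkQueue P s = some s') : s' = s := by
  unfold checkQueue at h
  split_ifs at h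
  exact (Option.some.inj h).symm

/-- The state of the compression phase after `r` reads and `w` writes. -/
def CompState.After (s : CompState α) (bucket : Fin P.B → List α) (r w : ℕ) : Prop :=
  s.out ++ s.queue = concatFirst bucket r ∧ s.out.length = P.D * w

theorem CompState.after_zero : CompState.After ⟨[], []⟩ bucket 0 0 := ⟨rfl, rfl⟩

theorem CompState.After.read (h : s.After bucket r w) (hr : r < P.B) :
    (importBucket (bucket ⟨r, hr⟩) s).After bucket (r + 1) w := by
  refine ⟨?_, h.2⟩
  rw [concatFirst_succ bucket hr, ← h.1, importBucket, List.append_assoc]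

theorem CompState.After.write (h : s.After bucket r w) (hs : drainQueue P s = some s') :
    s'.After bucket r (w + 1) := by
  unfold drainQueue at hs
  split_ifs at hs with hlt
  obtain rfl := Option.some.inj hs
  refine ⟨by rw [← h.1, List.append_assoc, List.take_append_drop], ?_⟩
  rw [List.length_append, h.2, List.length_take_of_le (not_lt.1 hlt), mul_add_one]

theorem CompState.After.length_queue (h : s.After bucket r w) :
    P.D * w + s.queue.length = (concatFirst bucket r).length := by
  rw [← h.1, List.length_append, h.2]

/-- The first phase of the compression: the first `L` intermediate buckets are read. -/
def firstReads (bucket : Fin P.B → List α) (L : ℕ) : Option (CompState α) :=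
  ((List.finRange P.B).take L).foldlM (fun s b => checkQueue P (importBucket (bucket b) s))
    { queue := [], out := [] }

/-- The second phase of the compression: `B - L` iterations of a read and a write. -/
def readWrites (bucket : Fin P.B → List α) (L : ℕ) (s : CompState α) : Option (CompState α) :=
  ((List.finRange P.B).drop L).foldlM
    (fun s b => (drainQueue P (importBucket (bucket b) s)).bind (checkQueue P)) s

/-- The last phase of the compression: the last `L` output buckets are written. -/
def lastWrites (P : Params) (L : ℕ) (s : CompState α) : Option (CompState α) :=
  ((List.finRange P.B).drop (P.B - L)).foldlM (fun s _ => drainQueue P s) s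

theorem compress_eq_bind (bucket : Fin P.B → List α) :
    compress P bucket = ((firstReads bucket (min P.W P.B)).bind fun s₁ =>
      (readWrites bucket (min P.W P.B) s₁).bind (lastWrites P (min P.W P.B))).map
        CompState.out := by
  simp only [compress, Option.map_eq_bind, Option.bind_assoc]
  rfl

variable {L : ℕ}

theorem after_of_firstReads_eq_some (hL : L ≤ P.B) (h : firstReads bucket L = some s) :
    s.After bucket L 0 := by
  simpa [hL] using invariant_of_foldlM_eq_some
    (Inv := fun k (s : CompState α) => s.After bucket k 0)
    (fun k hk s s' hInv hf => by
      have hk : k < P.B := by simp at hk; omega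
      simpa [eq_of_checkQueue_eq_some hf] using hInv.read hk)
    CompState.after_zero h

theorem after_of_readWrites_eq_some (hL : L ≤ P.B) (hs : s.After bucket L 0)
    (h : readWrites bucket L s = some s') : s'.After bucket P.B (P.B - L) := by
  simpa [hL] using invariant_of_foldlM_eq_some
    (Inv := fun k (s : CompState α) => s.After bucket (L + k) k)
    (fun k hk s s' hInv hf => by
      have hk : L + k < P.B := by simp at hk; omega
      obtain ⟨u, hu, hcheck⟩ := Option.bind_eq_some_iff.1 hf
      rw [eq_of_checkQueue_eq_some hcheck]
      exact (hInv.read hk).write (by simpa using hu))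
    hs h

theorem after_of_lastWrites_eq_some (hL : L ≤ P.B) (hs : s.After bucket P.B (P.B - L))
    (h : lastWrites P L s = some s') : s'.After bucket P.B P.B := by
  simpa [hL, Nat.sub_sub_self] using invariant_of_foldlM_eq_some
    (Inv := fun k (s : CompState α) => s.After bucket P.B (P.B - L + k))
    (fun _ _ _ _ hInv hf => hInv.write hf) hs h

theorem eq_flatten_of_compress_eq_some {l : List α} (hN : (List.ofFn bucket).flatten.length = P.N)
    (h : compress P bucket = some l) : l = (List.ofFn bucket).flatten := by
  rw [compress_eq_bind] at h
  obtain ⟨s₃, h₁₂₃, rfl⟩ := Option.map_eq_some_iff.1 h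
  obtain ⟨s₁, hs₁, h₂₃⟩ := Option.bind_eq_some_iff.1 h₁₂₃
  obtain ⟨s₂, hs₂, hs₃⟩ := Option.bind_eq_some_iff.1 h₂₃
  have hL : min P.W P.B ≤ P.B := min_le_right _ _
  have after : s₃.After bucket P.B P.B := after_of_lastWrites_eq_some hL
    (after_of_readWrites_eq_some hL (after_of_firstReads_eq_some hL hs₁) hs₂) hs₃
  have hqueue : s₃.queue = [] := by
    have := after.length_queue
    rw [concatFirst_self, hN, Params.N, mul_comm P.B] at this
    exact List.eq_nil_of_length_eq_zero (by omega)
  simpa [hqueue, concatFirst_self] using after.1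

theorem exists_firstReads_eq_some (hLB : L ≤ P.B) (hLW : L ≤ P.W)
    (hup : ∀ b : Fin P.B, (concatFirst bucket (b + 1)).length ≤ P.D * (b + 1) + P.Q) :
    ∃ s, firstReads bucket L = some s := by
  obtain ⟨s, hs, -⟩ := exists_foldlM_eq_some
    (f := fun s b => checkQueue P (importBucket (bucket b) s))
    (l := (List.finRange P.B).take L) (Inv := fun k (s : CompState α) => s.After bucket k 0)
    (fun k hk s hInv => by
      have hkL : k < L := by simp at hk; omega
      have hread : (importBucket (bucket ((List.finRange P.B).take L)[k]) s).After bucket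
          (k + 1) 0 := by
        simpa using hInv.read (hkL.trans_le hLB)
      refine ⟨_, if_pos ?_, hread⟩
      calc (importBucket (bucket ((List.finRange P.B).take L)[k]) s).queue.length
          = (concatFirst bucket (k + 1)).length := by simpa using hread.length_queue
        _ ≤ P.D * (k + 1) + P.Q := hup ⟨k, hkL.trans_le hLB⟩
        _ ≤ P.W * P.D + P.Q := by
          rw [mul_comm]; gcongr; exact hkL.trans_le hLW)
    CompState.after_zero
  exact ⟨s, hs⟩

theorem exists_readWrites_eq_some (hL : L < P.B → L = P.W) (hs : s.After bucket L 0)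
    (hlow : ∀ b : Fin P.B, P.D * (b + 1) ≤ (concatFirst bucket (b + 1)).length + P.D * P.W)
    (hup : ∀ b : Fin P.B, (concatFirst bucket (b + 1)).length ≤ P.D * (b + 1) + P.Q) :
    ∃ s', readWrites bucket L s = some s' := by
  obtain ⟨s', hs', -⟩ := exists_foldlM_eq_some
    (f := fun s b => (drainQueue P (importBucket (bucket b) s)).bind (checkQueue P))
    (l := (List.finRange P.B).drop L)
    (Inv := fun k (s : CompState α) => s.After bucket (L + k) k)
    (fun k hk s hInv => by
      have hkB : L + k < P.B := by simp at hk; omega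
      obtain rfl : L = P.W := hL (by omega)
      have hread := hInv.read hkB
      have hup := hup ⟨P.W + k, hkB⟩
      have hlow := hlow ⟨P.W + k, hkB⟩
      have hlen := hread.length_queue
      simp only [mul_add, mul_one] at hup hlow hlen
      obtain ⟨u, hu⟩ := exists_drainQueue_eq_some (P := P)
        (s := importBucket (bucket ⟨P.W + k, hkB⟩) s) (by omega)
      have hwrite := hread.write hu
      have hlen' := hwrite.length_queue
      simp only [mul_add, mul_one] at hlen'
      refine ⟨u, Option.bind_eq_some_iff.2 ⟨u, by simpa using hu, if_pos ?_⟩, hwrite⟩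
      rw [mul_comm P.W]
      omega)
    hs
  exact ⟨s', hs'⟩

theorem exists_lastWrites_eq_some (hN : (List.ofFn bucket).flatten.length = P.N) (hL : L ≤ P.B)
    (hs : s.After bucket P.B (P.B - L)) : ∃ s', lastWrites P L s = some s' := by
  obtain ⟨s', hs', -⟩ := exists_foldlM_eq_some
    (f := fun s (_ : Fin P.B) => drainQueue P s) (l := (List.finRange P.B).drop (P.B - L))
    (Inv := fun k (s : CompState α) => s.After bucket P.B (P.B - L + k))
    (fun k hk s hInv => by
      have hkL : P.B - L + k + 1 ≤ P.B := by simp at hk; omega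
      have hlen := hInv.length_queue
      rw [concatFirst_self, hN, Params.N, mul_comm P.B] at hlen
      have := Nat.mul_le_mul_left P.D hkL
      rw [mul_add_one] at this
      obtain ⟨u, hu⟩ := exists_drainQueue_eq_some (P := P) (s := s) (by omega)
      exact ⟨u, hu, hInv.write hu⟩)
    hs
  exact ⟨s', hs'⟩

theorem exists_compress_eq_some (hN : (List.ofFn bucket).flatten.length = P.N)
    (hlow : ∀ b : Fin P.B, P.D * (b + 1) ≤ (concatFirst bucket (b + 1)).length + P.D * P.W)
    (hup : ∀ b : Fin P.B, (concatFirst bucket (b + 1)).length ≤ P.D * (b + 1) + P.Q) :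
    ∃ l, compress P bucket = some l := by
  have hL : min P.W P.B ≤ P.B := min_le_right _ _
  obtain ⟨s₁, hs₁⟩ := exists_firstReads_eq_some hL (min_le_left _ _) hup
  have after₁ := after_of_firstReads_eq_some hL hs₁
  obtain ⟨s₂, hs₂⟩ := exists_readWrites_eq_some (by omega) after₁ hlow hup
  have after₂ := after_of_readWrites_eq_some hL after₁ hs₂
  obtain ⟨s₃, hs₃⟩ := exists_lastWrites_eq_some hN hL after₂
  exact ⟨s₃.out, by simp [compress_eq_bind, hs₁, hs₂, hs₃]⟩

end Compression

section ShuffleBucket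

variable {α β : Type*}

theorem map_some_filterMap (f : β → Option α) (l : List β) :
    (l.filterMap f).map some = (l.filter fun i => (f i).isSome).map f := by
  rw [List.map_filterMap_some_eq_filter_map_isSome, List.filter_map]
  rfl

theorem filter_isSome_eq_of_filterMap_eq {f : β → Option α}
    (hf : Set.InjOn f {i | (f i).isSome}) {l l' : List β} (h : l.filterMap f = l'.filterMap f) :
    (l.filter fun i => (f i).isSome) = l'.filter fun i => (f i).isSome := by
  have hmap := congrArg (List.map some) h
  simp only [map_some_filterMap] at hmap
  refine List.ext_getElem (by simpa using congrArg List.length hmap) fun k hk hk' =>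
    hf (List.mem_filter.1 (List.getElem_mem hk)).2 (List.mem_filter.1 (List.getElem_mem hk')).2 ?_
  exact (List.getElem_map f).symm.trans
    ((List.getElem_of_eq hmap (by simpa using hk)).trans (List.getElem_map f))

theorem filter_ofFn_ofSubtype_mul {m : ℕ} (p : Fin m → Bool) (ρ : Equiv.Perm {i // p i})
    (σ : Equiv.Perm (Fin m)) :
    (List.ofFn (Equiv.Perm.ofSubtype ρ * σ)).filter p =
      ((List.ofFn σ).filter p).map (Equiv.Perm.ofSubtype ρ) := by
  have hp : p ∘ Equiv.Perm.ofSubtype ρ = p := by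
    funext i
    exact Bool.eq_iff_iff.2 (Equiv.Perm.ofSubtype_apply_mem_iff_mem ρ i)
  rw [Equiv.Perm.coe_mul, ← List.map_ofFn, List.filter_map, hp]

/-- Permuting the elements of `p` among themselves acts freely on the permutations of `Fin m` and
maps the fibre over `l` to distinct fibres. -/
theorem card_filter_ofFn_eq_mul_factorial_le {m : ℕ} (p : Fin m → Bool) (l : List (Fin m)) :
    #{σ : Equiv.Perm (Fin m) | (List.ofFn σ).filter p = l} * (Fintype.card {i // p i})! ≤ m ! := by
  have hcard : Fintype.card (Equiv.Perm (Fin m)) = m ! := by simp [Fintype.card_perm]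
  rw [← hcard, ← Fintype.card_perm, ← Finset.card_univ, ← Finset.card_univ, ← Finset.card_product]
  refine Finset.card_le_card_of_injOn (fun x => Equiv.Perm.ofSubtype x.2 * x.1)
    (fun _ _ => Finset.mem_univ _) ?_
  rintro ⟨σ, ρ⟩ hσ ⟨σ', ρ'⟩ hσ' h
  simp only [Finset.coe_product, Finset.coe_univ, Set.mem_prod, Finset.mem_coe, Finset.mem_filter,
    Finset.mem_univ, true_and, Set.mem_univ, and_true] at hσ hσ' h
  have hmap : l.map (Equiv.Perm.ofSubtype ρ) = l.map (Equiv.Perm.ofSubtype ρ') := by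
    rw [← hσ, ← filter_ofFn_ofSubtype_mul, h, filter_ofFn_ofSubtype_mul, hσ', hσ]
  obtain rfl : ρ = ρ' := by
    ext ⟨i, hi⟩
    have hil : i ∈ l := by
      rw [← hσ, List.mem_filter]
      exact ⟨List.mem_ofFn.2 ⟨σ.symm i, by simp⟩, hi⟩
    have hi' := List.map_inj_left.1 hmap i hil
    rw [Equiv.Perm.ofSubtype_apply_of_mem ρ hi, Equiv.Perm.ofSubtype_apply_of_mem ρ' hi] at hi'
    rw [hi']
  rw [mul_left_cancel h]

variable {P : Params} {bucket : List (Option α)}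

theorem shuffleBucket_eq_filterMap (σ : Equiv.Perm (Fin P.slots)) (bucket : List (Option α)) :
    shuffleBucket P σ bucket =
      (List.ofFn σ).filterMap fun i : Fin P.slots => bucket.getD i none := by
  rw [shuffleBucket, List.reduceOption, List.ofFn_comp' σ fun i : Fin _ => bucket.getD i none,
    List.filterMap_map]
  rfl

theorem reduceOption_eq_filterMap {m : ℕ} (hm : bucket.length = m) :
    bucket.reduceOption = (List.finRange m).filterMap fun i : Fin m => bucket.getD i none := by
  subst hm
  conv_lhs =>
    rw [List.reduceOption, ← List.ofFn_getElem (xs := bucket), List.ofFn_eq_map,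
      List.filterMap_map]
  simp

theorem shuffleBucket_perm (σ : Equiv.Perm (Fin P.slots)) (hb : bucket.length = P.slots) :
    (shuffleBucket P σ bucket).Perm bucket.reduceOption := by
  rw [shuffleBucket_eq_filterMap, reduceOption_eq_filterMap hb, ← List.ofFn_id]
  exact (Equiv.Perm.ofFn_comp_perm σ id).filterMap _

theorem card_shuffleBucket_eq_mul_factorial_le [DecidableEq α]
    (hb : bucket.length = P.slots) (hnodup : bucket.reduceOption.Nodup) (l : List α) :
    #{σ | shuffleBucket P σ bucket = l} * (bucket.reduceOption.length)! ≤ P.slots ! := by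
  set f : Fin P.slots → Option α := fun i => bucket.getD i none
  have hmap := map_some_filterMap f (List.finRange P.slots)
  rw [← reduceOption_eq_filterMap hb] at hmap
  have hinj : Set.InjOn f {i | (f i).isSome} := fun i hi i' hi' =>
    List.inj_on_of_nodup_map (hmap ▸ hnodup.map (Option.some_injective α))
      (by simpa using hi) (by simpa using hi')
  have hcard : bucket.reduceOption.length = Fintype.card {i // (f i).isSome} := by
    rw [← List.length_map some, hmap, List.length_map, Fintype.card_subtype]
    simp [Finset.card_def, Fin.univ_def]
  rw [hcard]
  obtain hempty | ⟨σ₀, hσ₀⟩ := Finset.eq_empty_or_nonempty {σ | shuffleBucket P σ bucket = l}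
  · simp [hempty]
  refine le_trans (Nat.mul_le_mul_right _ (Finset.card_le_card fun σ hσ => ?_))
    (card_filter_ofFn_eq_mul_factorial_le (fun i => (f i).isSome)
      ((List.ofFn σ₀).filter fun i => (f i).isSome))
  simp only [Finset.mem_filter, Finset.mem_univ, true_and] at hσ hσ₀ ⊢
  refine filter_isSome_eq_of_filterMap_eq hinj ?_
  rw [← shuffleBucket_eq_filterMap, ← shuffleBucket_eq_filterMap, hσ, hσ₀]

end ShuffleBucket

section Uniformity

theorem ofFn_flatten_injective {α : Type*} {n : ℕ} {u v : Fin n → List α}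
    (hlen : ∀ j, (u j).length = (v j).length)
    (h : (List.ofFn u).flatten = (List.ofFn v).flatten) : u = v :=
  List.ofFn_injective (List.eq_iff_flatten_eq.2 ⟨h, by
    simp only [List.map_ofFn, Function.comp_def, hlen]⟩)

theorem sum_multinomial_le {ι κ : Type*} [Fintype ι] {s : Finset κ} {N : ℕ}
    {n : κ → ι → ℕ} (hinj : Set.InjOn n s) (hsum : ∀ a ∈ s, ∑ j, n a j = N) :
    ∑ a ∈ s, Nat.multinomial Finset.univ (n a) ≤ Fintype.card ι ^ N := by
  classical
  calc ∑ a ∈ s, Nat.multinomial Finset.univ (n a)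
      = ∑ k ∈ s.image n, Nat.multinomial Finset.univ k := (Finset.sum_image hinj).symm
    _ ≤ ∑ k ∈ Finset.piAntidiag Finset.univ N, Nat.multinomial Finset.univ k := by
      refine Finset.sum_le_sum_of_subset fun k hk => ?_
      obtain ⟨a, ha, rfl⟩ := Finset.mem_image.1 hk
      exact Finset.mem_piAntidiag.2 ⟨hsum a ha, fun _ _ => Finset.mem_univ _⟩
    _ = Fintype.card ι ^ N := by
      simpa using (Finset.sum_pow_eq_sum_piAntidiag (Finset.univ : Finset ι)
        (fun _ => (1 : ℕ)) N).symm

variable {α : Type*} {P : Params} {T T' : Fin P.B → Fin P.D → Fin P.B}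
  {σ σ' : Fin P.B → Equiv.Perm (Fin P.slots)} {input : Fin P.N → α}

theorem mem_arrivals {j : Fin P.B} {x : α} :
    x ∈ arrivals T input j P.B ↔ ∃ b i, T b i = j ∧ input (P.dataIdx b i) = x := by
  simp [arrivals, itemsFor, mem_concatFirst_self, eq_comm (a := x)]

theorem apply_mem_arrivals_iff (hinput : Function.Injective input) {b : Fin P.B} {i : Fin P.D}
    {j : Fin P.B} : input (P.dataIdx b i) ∈ arrivals T input j P.B ↔ T b i = j := by
  rw [mem_arrivals]
  refine ⟨?_, fun h => ⟨b, i, h, rfl⟩⟩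
  rintro ⟨b', i', rfl, h⟩
  obtain ⟨rfl, rfl⟩ := Prod.mk.inj (finProdFinEquiv.injective (hinput h))
  rfl

theorem nodup_arrivals (hinput : Function.Injective input) (j : Fin P.B) :
    (arrivals T input j P.B).Nodup := by
  have hle : (arrivals T input j P.B : Multiset α) ≤ Finset.univ.val.map input := by
    rw [← Multiset.sum_map_singleton (Finset.univ.val.map input), Multiset.map_map]
    exact (Finset.single_le_sum (fun _ _ => Multiset.zero_le _) (Finset.mem_univ j)).trans_eq
      (sum_arrivals_self T input)
  exact Multiset.nodup_of_le hle (Finset.univ.nodup.map hinput)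

theorem sum_length_arrivals (T : Fin P.B → Fin P.D → Fin P.B) (input : Fin P.N → α) :
    ∑ j, (arrivals T input j P.B).length = P.N := by
  simpa using congrArg Multiset.card (sum_arrivals_self T input)

theorem shuffleBucket_perm_arrivals {mid : Fin P.B → List (Option α)}
    (hmid : distribute P T input = some mid) (σ : Equiv.Perm (Fin P.slots)) (j : Fin P.B) :
    (shuffleBucket P σ (mid j)).Perm (arrivals T input j P.B) := by
  obtain ⟨hlen, heq⟩ := length_and_reduceOption_of_distribute_eq_some hmid j
  exact heq ▸ shuffleBucket_perm σ hlen

theorem length_flatten_shuffleBucket {mid : Fin P.B → List (Option α)}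
    (hmid : distribute P T input = some mid) (σ : Fin P.B → Equiv.Perm (Fin P.slots)) :
    (List.ofFn fun j => shuffleBucket P (σ j) (mid j)).flatten.length = P.N := by
  rw [List.length_flatten, List.map_ofFn, List.sum_ofFn, ← sum_length_arrivals T input]
  exact Finset.sum_congr rfl fun j _ => (shuffleBucket_perm_arrivals hmid (σ j) j).length_eq

theorem eq_flatten_of_run_eq_some {mid : Fin P.B → List (Option α)} {l : List α}
    (hmid : distribute P T input = some mid) (h : run P (T, σ) input = some l) :
    l = (List.ofFn fun j => shuffleBucket P (σ j) (mid j)).flatten := by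
  rw [run, hmid] at h
  exact eq_flatten_of_compress_eq_some (length_flatten_shuffleBucket hmid σ) h

theorem exists_perm_arrivals_of_run_eq_some {l : List α} (h : run P (T, σ) input = some l) :
    ∃ bucket : Fin P.B → List α, (∀ j, (bucket j).Perm (arrivals T input j P.B)) ∧
      l = (List.ofFn bucket).flatten := by
  obtain ⟨mid, hmid, -⟩ := Option.bind_eq_some_iff.1 h
  exact ⟨_, fun j => shuffleBucket_perm_arrivals hmid (σ j) j, eq_flatten_of_run_eq_some hmid h⟩

theorem coe_eq_of_run_eq_some {ω : Coins P} {l : List α} (h : run P ω input = some l) :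
    (l : Multiset α) = ∑ i, {input i} := by
  obtain ⟨bucket, hperm, rfl⟩ := exists_perm_arrivals_of_run_eq_some h
  rw [← concatFirst_self, coe_concatFirst_self, ← sum_arrivals_self ω.1 input]
  exact Finset.sum_congr rfl fun j _ => Multiset.coe_eq_coe.2 (hperm j)

theorem targets_eq_of_run_eq_some (hinput : Function.Injective input) {l : List α}
    (h : run P (T, σ) input = some l) (h' : run P (T', σ') input = some l)
    (hlen : ∀ j, (arrivals T input j P.B).length = (arrivals T' input j P.B).length) :
    T = T' := by
  obtain ⟨bucket, hperm, rfl⟩ := exists_perm_arrivals_of_run_eq_some h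
  obtain ⟨bucket', hperm', heq⟩ := exists_perm_arrivals_of_run_eq_some h'
  obtain rfl : bucket = bucket' := ofFn_flatten_injective
    (fun j => by rw [(hperm j).length_eq, (hperm' j).length_eq, hlen]) heq
  funext b i
  rw [eq_comm, ← apply_mem_arrivals_iff hinput, ← (hperm' _).mem_iff, (hperm _).mem_iff,
    apply_mem_arrivals_iff hinput]

theorem card_run_eq_some_mul_prod_factorial_le [DecidableEq α]
    (hinput : Function.Injective input) (T : Fin P.B → Fin P.D → Fin P.B) (l : List α) :
    #{σ | run P (T, σ) input = some l} * ∏ j, (arrivals T input j P.B).length ! ≤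
      P.slots ! ^ P.B := by
  obtain hempty | ⟨σ₀, hσ₀⟩ := Finset.eq_empty_or_nonempty {σ | run P (T, σ) input = some l}
  · simp [hempty]
  replace hσ₀ := (Finset.mem_filter.1 hσ₀).2
  obtain ⟨mid, hmid, -⟩ := Option.bind_eq_some_iff.1 hσ₀
  have hsub : ({σ | run P (T, σ) input = some l} : Finset _) ⊆
      Fintype.piFinset fun j =>
        {ρ | shuffleBucket P ρ (mid j) = shuffleBucket P (σ₀ j) (mid j)} := by
    intro σ hσ
    have heq := ofFn_flatten_injective (fun j => by
        rw [(shuffleBucket_perm_arrivals hmid _ j).length_eq,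
          (shuffleBucket_perm_arrivals hmid _ j).length_eq])
      ((eq_flatten_of_run_eq_some hmid (Finset.mem_filter.1 hσ).2).symm.trans
        (eq_flatten_of_run_eq_some hmid hσ₀))
    simpa using congrFun heq
  calc #{σ | run P (T, σ) input = some l} * ∏ j, (arrivals T input j P.B).length !
      ≤ ∏ j, #{ρ | shuffleBucket P ρ (mid j) = shuffleBucket P (σ₀ j) (mid j)} *
          (arrivals T input j P.B).length ! := by
        rw [Finset.prod_mul_distrib, ← Fintype.card_piFinset]
        exact Nat.mul_le_mul_right _ (Finset.card_le_card hsub)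
    _ ≤ ∏ _j : Fin P.B, P.slots ! := Finset.prod_le_prod' fun j _ => by
        obtain ⟨hlen, heq⟩ := length_and_reduceOption_of_distribute_eq_some hmid j
        rw [← heq]
        exact card_shuffleBucket_eq_mul_factorial_le hlen (heq ▸ nodup_arrivals hinput j) _
    _ = P.slots ! ^ P.B := by simp

theorem card_coins (P : Params) : Fintype.card (Coins P) = P.slots ! ^ P.B * P.B ^ P.N := by
  simp [Coins, Fintype.card_perm, ← pow_mul, mul_comm]

theorem card_run_eq_some_mul_factorial_le [DecidableEq α] (hinput : Function.Injective input)
    (l : List α) :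
    #{ω : Coins P | run P ω input = some l} * P.N ! ≤ Fintype.card (Coins P) := by
  classical
  set G : Finset (Fin P.B → Fin P.D → Fin P.B) := {T | ∃ σ, run P (T, σ) input = some l}
  have hinj : Set.InjOn (fun T j => (arrivals T input j P.B).length) G := by
    intro T hT T' hT' h
    obtain ⟨σ, hσ⟩ := (Finset.mem_filter.1 hT).2
    obtain ⟨σ', hσ'⟩ := (Finset.mem_filter.1 hT').2
    exact targets_eq_of_run_eq_some hinput hσ hσ' (congrFun h)
  have hcard : #{ω : Coins P | run P ω input = some l} =
      ∑ T ∈ G, #{σ | run P (T, σ) input = some l} := by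
    simp only [Finset.card_filter]
    rw [Fintype.sum_prod_type]
    refine (Finset.sum_subset (Finset.subset_univ G) fun T _ hT => ?_).symm
    simpa [G] using hT
  calc #{ω : Coins P | run P ω input = some l} * P.N !
      = ∑ T ∈ G, #{σ | run P (T, σ) input = some l} * P.N ! := by
        rw [← Finset.sum_mul, hcard]
    _ ≤ ∑ T ∈ G, P.slots ! ^ P.B *
          Nat.multinomial Finset.univ fun j => (arrivals T input j P.B).length := by
        refine Finset.sum_le_sum fun T _ => ?_
        rw [← sum_length_arrivals T input, ← Nat.multinomial_spec, ← mul_assoc]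
        exact Nat.mul_le_mul_right _ (card_run_eq_some_mul_prod_factorial_le hinput T l)
    _ ≤ P.slots ! ^ P.B * P.B ^ P.N := by
        rw [← Finset.mul_sum]
        refine Nat.mul_le_mul_left _ ?_
        simpa using sum_multinomial_le hinj fun T _ => sum_length_arrivals T input
    _ = Fintype.card (Coins P) := (card_coins P).symm

end Uniformity

section Distance

theorem map_uniformOfFintype_apply {Ω β : Type*} [Fintype Ω] [Nonempty Ω] [DecidableEq β]
    (f : Ω → β) (b : β) :
    (PMF.uniformOfFintype Ω).map f b = (#{ω | f ω = b} : ENNReal) / Fintype.card Ω := by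
  simp only [PMF.map_apply, tsum_fintype, PMF.uniformOfFintype_apply, eq_comm (a := b)]
  rw [← Finset.sum_filter, Finset.sum_const, nsmul_eq_mul, div_eq_mul_inv]

theorem toReal_toOuterMeasure_compl {β : Type*} (p : PMF β) (A : Set β) :
    (p.toOuterMeasure Aᶜ).toReal = 1 - (p.toOuterMeasure A).toReal := by
  let _ : MeasurableSpace β := ⊤
  simp only [← PMF.toMeasure_apply_eq_toOuterMeasure]
  exact MeasureTheory.probReal_compl_eq_one_sub MeasurableSpace.measurableSet_top

theorem toReal_toOuterMeasure_le_add {β : Type*} {p q : PMF β} {b : β}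
    (h : ∀ a ≠ b, p a ≤ q a) (A : Set β) :
    (p.toOuterMeasure A).toReal ≤ (q.toOuterMeasure A).toReal + (p b).toReal := by
  have hq : q.toOuterMeasure A ≠ ⊤ := by
    let _ : MeasurableSpace β := ⊤
    exact PMF.toMeasure_apply_eq_toOuterMeasure q A ▸ MeasureTheory.measure_ne_top _ _
  have hdiff : p.toOuterMeasure (A \ {b}) ≤ q.toOuterMeasure (A \ {b}) := by
    rw [PMF.toOuterMeasure_apply, PMF.toOuterMeasure_apply]
    refine ENNReal.tsum_le_tsum fun a => Set.indicator_le_indicator' fun ha => h a ha.2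
  rw [← ENNReal.toReal_add hq (p.apply_ne_top b)]
  refine ENNReal.toReal_mono (ENNReal.add_ne_top.2 ⟨hq, p.apply_ne_top b⟩) ?_
  calc p.toOuterMeasure A
      ≤ p.toOuterMeasure (A \ {b} ∪ {b}) := MeasureTheory.measure_mono (by simp)
    _ ≤ p.toOuterMeasure (A \ {b}) + p.toOuterMeasure {b} := MeasureTheory.measure_union_le _ _
    _ ≤ q.toOuterMeasure A + p b := by
        rw [PMF.toOuterMeasure_apply_singleton]
        exact add_le_add_left (hdiff.trans (MeasureTheory.measure_mono Set.sdiff_subset)) _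

theorem statDist_le_of_forall_ne {β : Type*} {p q : PMF β} {b : β} (h : ∀ a ≠ b, p a ≤ q a) :
    statDist p q ≤ (p b).toReal := by
  refine ciSup_le fun A => abs_le.2 ⟨?_, ?_⟩
  · have hcompl := toReal_toOuterMeasure_le_add h Aᶜ
    rw [toReal_toOuterMeasure_compl, toReal_toOuterMeasure_compl] at hcompl
    linarith
  · linarith [toReal_toOuterMeasure_le_add h A]

theorem inv_factorial_le_uniformDist {n : ℕ} {l : List (Fin n)}
    (hl : (l : Multiset (Fin n)) = Finset.univ.val) :
    (n ! : ENNReal)⁻¹ ≤ uniformDist n (some l) := by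
  have hnodup : l.Nodup := Multiset.coe_nodup.1 (hl ▸ Finset.univ.nodup)
  have hlen : l.length = n := by simpa using congrArg Multiset.card hl
  let π : Equiv.Perm (Fin n) := Equiv.ofBijective (fun i => l.get (i.cast hlen.symm)) <|
    Finite.injective_iff_bijective.1 <|
      (List.nodup_iff_injective_get.1 hnodup).comp (Fin.cast_injective _)
  have hπ : List.ofFn (fun i => π i) = l := List.ext_get (by simp [hlen]) (by simp [π])
  rw [uniformDist, map_uniformOfFintype_apply, Fintype.card_perm, Fintype.card_fin,
    ← one_div]
  gcongr
  exact_mod_cast Finset.card_pos.2 ⟨π, by simp [hπ]⟩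

theorem outputDist_some_le_inv_factorial {α : Type*} {P : Params} {input : Fin P.N → α}
    (hinput : Function.Injective input) (l : List α) :
    outputDist P input (some l) ≤ (P.N ! : ENNReal)⁻¹ := by
  classical
  rw [outputDist, map_uniformOfFintype_apply]
  refine ENNReal.div_le_of_le_mul ?_
  rw [← ENNReal.div_eq_inv_mul, ENNReal.le_div_iff_mul_le (by simp [Nat.factorial_ne_zero])
    (by simp)]
  exact_mod_cast card_run_eq_some_mul_factorial_le hinput l

theorem statDist_le_outputDist_none (P : Params) (input : Equiv.Perm (Fin P.N)) :
    statDist (outputDist P input) (uniformDist P.N) ≤ (outputDist P input none).toReal := by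
  refine statDist_le_of_forall_ne fun a ha => ?_
  obtain ⟨l, rfl⟩ := Option.ne_none_iff_exists'.1 ha
  by_cases hl : ∃ ω, run P ω input = some l
  · obtain ⟨ω, hω⟩ := hl
    refine (outputDist_some_le_inv_factorial input.injective l).trans
      (inv_factorial_le_uniformDist ?_)
    rw [coe_eq_of_run_eq_some hω, Equiv.sum_comp input fun i => ({i} : Multiset (Fin P.N))]
    simp
  · rw [outputDist, map_uniformOfFintype_apply]
    push Not at hl
    simp [hl]

end Distance

section Failure

variable {α : Type*} {P : Params}

/-- The number of items with a target in `A`. -/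
def load (T : Fin P.B → Fin P.D → Fin P.B) (A : Finset (Fin P.B)) : ℕ :=
  #{p : Fin P.B × Fin P.D | T p.1 p.2 ∈ A}

theorem load_add_load_compl (T : Fin P.B → Fin P.D → Fin P.B) (A : Finset (Fin P.B)) :
    load T A + load T Aᶜ = P.N := by
  simp only [load, Finset.mem_compl]
  rw [Finset.card_filter_add_card_filter_not]
  simp

theorem sum_length_arrivals_mem (T : Fin P.B → Fin P.D → Fin P.B) (input : Fin P.N → α)
    (A : Finset (Fin P.B)) : ∑ j ∈ A, (arrivals T input j P.B).length = load T A := by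
  simp only [arrivals, length_concatFirst, length_itemsFor_self, load, Finset.card_filter,
    Fintype.sum_prod_type, Fin.is_lt, Finset.filter_true]
  rw [Finset.sum_comm]
  refine Finset.sum_congr rfl fun b _ => ?_
  rw [Finset.sum_comm]
  simp

theorem sum_backlog_lt {T : Fin P.B → Fin P.D → Fin P.B} {b : Fin P.B}
    (h : ∀ j, (backlog P.C (fun c => #{i | T c i = j}) (b + 1) : ℝ) < P.S / P.B) :
    ∑ j, backlog P.C (fun c => #{i | T c i = j}) (b + 1) < P.S := by
  have hB : (P.B : ℝ) ≠ 0 := Nat.cast_ne_zero.2 b.pos.ne'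
  suffices (∑ j, (backlog P.C (fun c => #{i | T c i = j}) (b + 1) : ℝ)) < P.S by exact_mod_cast this
  calc ∑ j, (backlog P.C (fun c => #{i | T c i = j}) (b + 1) : ℝ)
      < ∑ _j : Fin P.B, (P.S / P.B : ℝ) :=
        Finset.sum_lt_sum_of_nonempty ⟨b, Finset.mem_univ b⟩ fun j _ => h j
    _ = P.S := by simp [mul_div_cancel₀ _ hB]

theorem exists_run_eq_some {ω : Coins P} {input : Fin P.N → α} (hK : (P.S : ℝ) / P.B ≤ P.K)
    (hstash : ∀ j (b : Fin P.B),
      (backlog P.C (fun c => #{i | ω.1 c i = j}) (b + 1) : ℝ) < P.S / P.B)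
    (hlow : ∀ b : Fin P.B, P.D * (b + 1) ≤ load ω.1 (Finset.Iic b) + P.D * P.W)
    (hup : ∀ b : Fin P.B, load ω.1 (Finset.Iic b) ≤ P.D * (b + 1) + P.Q) :
    ∃ l, run P ω input = some l := by
  obtain ⟨mid, hmid⟩ : ∃ mid, distribute P ω.1 input = some mid := by
    refine exists_distribute_eq_some (fun b => sum_backlog_lt fun j => hstash j b) fun j => ?_
    have hlast := hstash j ⟨P.B - 1, Nat.sub_lt j.pos one_pos⟩
    simp only [Nat.sub_one_add_one j.pos.ne'] at hlast
    exact_mod_cast hlast.le.trans hK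
  have hlen : ∀ b : Fin P.B,
      (concatFirst (fun j => shuffleBucket P (ω.2 j) (mid j)) (b + 1)).length =
        load ω.1 (Finset.Iic b) := by
    intro b
    rw [length_concatFirst, ← sum_length_arrivals_mem ω.1 input]
    refine Finset.sum_congr (by ext; simp) fun j _ => ?_
    exact (shuffleBucket_perm_arrivals hmid (ω.2 j) j).length_eq
  rw [run, hmid]
  exact exists_compress_eq_some (length_flatten_shuffleBucket hmid ω.2)
    (fun b => (hlow b).trans_eq (by rw [hlen])) (fun b => (hlen b).trans_le (hup b))

end Failure

section Tails

open MeasureTheory ProbabilityTheory Real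

variable {Ω : Type*} [MeasurableSpace Ω] {μ : Measure Ω}

theorem measureReal_le_sum_indicator_sub_le {ι : Type*} [Fintype ι] {E : ι → Set Ω}
    (hE : ∀ i, MeasurableSet (E i)) (hindep : iIndepSet E μ) {r : ℝ} (hr : 0 ≤ r) :
    μ.real {ω | r ≤ ∑ i, ((E i).indicator 1 ω - μ.real (E i))} ≤
      exp (-2 * r ^ 2 / Fintype.card ι) := by
  have := hindep.isProbabilityMeasure
  have hsub (i) : HasSubgaussianMGF (fun ω => (E i).indicator (1 : Ω → ℝ) ω - μ.real (E i))
      ((‖(1 : ℝ) - 0‖₊ / 2) ^ 2) μ := by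
    rw [← integral_indicator_one (hE i)]
    exact hasSubgaussianMGF_of_mem_Icc (measurable_one.indicator (hE i)).aemeasurable
      (ae_of_all _ fun ω => ⟨Set.indicator_nonneg (by simp) ω, Set.indicator_le_self' (by simp) ω⟩)
  have hcenter := hindep.iIndepFun_indicator.comp (fun i (x : ℝ) => x - μ.real (E i))
    fun i => by fun_prop
  refine (HasSubgaussianMGF.measure_sum_ge_le_of_iIndepFun hcenter (fun i _ => hsub i) hr).trans_eq
    ?_
  congr 1
  simp
  ring

theorem mgf_indicator_one [IsProbabilityMeasure μ] {E : Set Ω} (hE : MeasurableSet E) (t : ℝ) :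
    mgf (E.indicator 1) μ t = 1 + (exp t - 1) * μ.real E := by
  have hexp (ω) : exp (t * E.indicator 1 ω) = 1 + (exp t - 1) * E.indicator 1 ω := by
    by_cases hω : ω ∈ E <;> simp [hω]
  simp_rw [mgf, hexp]
  rw [integral_add (integrable_const _)
    (((integrable_const 1).indicator hE).const_mul _), integral_const_mul,
    integral_indicator_one hE]
  simp

theorem mgf_sum_indicator_one_le {ι : Type*} {E : ι → Set Ω} (hE : ∀ i, MeasurableSet (E i))
    (hindep : iIndepSet E μ) (s : Finset ι) (t : ℝ) :
    mgf (∑ i ∈ s, (E i).indicator 1) μ t ≤ exp ((exp t - 1) * ∑ i ∈ s, μ.real (E i)) := by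
  have := hindep.isProbabilityMeasure
  have hsum : mgf (∑ i ∈ s, (E i).indicator 1) μ t = ∏ i ∈ s, mgf ((E i).indicator 1) μ t :=
    hindep.iIndepFun_indicator.mgf_sum (fun i => measurable_one.indicator (hE i)) s
  rw [hsum, Finset.mul_sum, exp_sum]
  refine Finset.prod_le_prod (fun _ _ => mgf_nonneg) fun i _ => ?_
  rw [mgf_indicator_one (hE i), add_comm]
  exact add_one_le_exp _

theorem exp_mul_backlog_succ_le {n C : ℕ} (x : Fin n → ℕ) (t : ℝ) {k : ℕ} (hk : k < n) :
    exp (t * backlog C x (k + 1)) ≤ 1 + exp (t * (backlog C x k + (x ⟨k, hk⟩ - C))) := by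
  rw [backlog_succ x hk]
  rcases le_total C (backlog C x k + x ⟨k, hk⟩) with h | h
  · rw [Nat.cast_sub h, Nat.cast_add, add_sub_assoc]
    exact le_add_of_nonneg_left zero_le_one
  · rw [Nat.sub_eq_zero_of_le h]
    simp [exp_nonneg]

theorem backlog_congr {n C : ℕ} {x y : Fin n → ℕ} {k : ℕ} (h : ∀ i, i.val < k → x i = y i) :
    backlog C x k = backlog C y k := by
  induction k with
  | zero => rfl
  | succ k ih =>
    rw [backlog, backlog, ih fun i hi => h i (by omega)]
    congr 2
    split_ifs with hk
    · exact h _ (Nat.lt_succ_self k)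
    · rfl

theorem indepFun_backlog_increment {n : ℕ} {X : Fin n → Ω → ℕ} (hX : ∀ i, Measurable (X i))
    (hindep : iIndepFun X μ) (C : ℕ) {k : ℕ} (hk : k < n) :
    IndepFun (fun ω => (backlog C (fun i => X i ω) k : ℝ)) (fun ω => (X ⟨k, hk⟩ ω - C : ℝ)) μ := by
  let s : Finset (Fin n) := {i | i.val < k}
  have hpair := hindep.indepFun_finset s {⟨k, hk⟩} (by simp [s]) hX
  refine (hpair.comp
    (measurable_of_countable fun y =>
      (backlog C (fun i => if hi : i ∈ s then y ⟨i, hi⟩ else 0) k : ℝ))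
    (measurable_of_countable fun y => (y ⟨⟨k, hk⟩, by simp⟩ - C : ℝ))).congr ?_ ?_
  · exact ae_of_all _ fun ω => congrArg Nat.cast (backlog_congr fun i hi => by simp [s, hi])
  · exact ae_of_all _ fun ω => rfl

theorem integrable_exp_mul_backlog {n C : ℕ} {X : Fin n → Ω → ℕ} (hX : ∀ i, Measurable (X i))
    (hindep : iIndepFun X μ) {t : ℝ} (hint : ∀ i, Integrable (fun ω => exp (t * (X i ω - C))) μ)
    {k : ℕ} (hk : k ≤ n) : Integrable (fun ω => exp (t * backlog C (fun i => X i ω) k)) μ := by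
  have := hindep.isProbabilityMeasure
  induction k with
  | zero => simp [backlog]
  | succ k ih =>
    have hmeas : Measurable fun ω => exp (t * backlog C (fun i => X i ω) (k + 1)) :=
      (measurable_of_countable fun x : Fin n → ℕ => exp (t * backlog C x (k + 1))).comp
        (measurable_pi_lambda _ hX)
    have hstep : Integrable
        (fun ω => exp (t * (backlog C (fun i => X i ω) k + (X ⟨k, hk⟩ ω - C)))) μ :=
      (indepFun_backlog_increment hX hindep C hk).integrable_exp_mul_add
        (ih (Nat.le_of_succ_le hk)) (hint ⟨k, hk⟩)
    refine ((integrable_const 1).add hstep).mono' hmeas.aestronglyMeasurable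
      (ae_of_all _ fun ω => ?_)
    rw [norm_of_nonneg (exp_nonneg _)]
    exact exp_mul_backlog_succ_le _ t hk

/- The moments satisfy `E (k + 1) ≤ 1 + ρ * E k`, and `(1 - ρ)⁻¹` is the fixed point of this
recursion. -/
theorem mgf_backlog_le {n C : ℕ} {X : Fin n → Ω → ℕ} (hX : ∀ i, Measurable (X i))
    (hindep : iIndepFun X μ) {t ρ : ℝ} (hint : ∀ i, Integrable (fun ω => exp (t * (X i ω - C))) μ)
    (hρ₀ : 0 ≤ ρ) (hρ₁ : ρ < 1) (hmgf : ∀ i, mgf (fun ω => (X i ω - C : ℝ)) μ t ≤ ρ)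
    {k : ℕ} (hk : k ≤ n) : mgf (fun ω => (backlog C (fun i => X i ω) k : ℝ)) μ t ≤ (1 - ρ)⁻¹ := by
  have := hindep.isProbabilityMeasure
  induction k with
  | zero =>
    simp only [backlog, Nat.cast_zero, mul_zero, exp_zero, mgf_const]
    exact (one_le_inv₀ (by linarith)).2 (by linarith)
  | succ k ih =>
    have hadd := indepFun_backlog_increment hX hindep C hk
    have hintk := integrable_exp_mul_backlog hX hindep hint (Nat.le_of_succ_le hk)
    have hstep : Integrable
        (fun ω => exp (t * (backlog C (fun i => X i ω) k + (X ⟨k, hk⟩ ω - C)))) μ :=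
      hadd.integrable_exp_mul_add hintk (hint ⟨k, hk⟩)
    calc mgf (fun ω => (backlog C (fun i => X i ω) (k + 1) : ℝ)) μ t
        ≤ ∫ ω, 1 + exp (t * (backlog C (fun i => X i ω) k + (X ⟨k, hk⟩ ω - C))) ∂μ :=
          integral_mono (integrable_exp_mul_backlog hX hindep hint hk)
            ((integrable_const 1).add hstep)
            fun ω => exp_mul_backlog_succ_le _ t hk
      _ = 1 + mgf (fun ω => (backlog C (fun i => X i ω) k : ℝ)) μ t *
            mgf (fun ω => (X ⟨k, hk⟩ ω - C : ℝ)) μ t := by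
          rw [← hadd.mgf_add hintk.1 (hint ⟨k, hk⟩).1, integral_add (integrable_const 1) hstep]
          simp [mgf]
      _ ≤ 1 + (1 - ρ)⁻¹ * ρ := by
          gcongr
          · exact mgf_nonneg
          · exact ih (Nat.le_of_succ_le hk)
          · exact hmgf _
      _ = (1 - ρ)⁻¹ := by
          have : 1 - ρ ≠ 0 := by linarith
          field_simp
          ring

end Tails

section UniformTargets

open MeasureTheory ProbabilityTheory Real

theorem iIndepSet_preimage_of_iIndepFun {Ω ι : Type*} {β : ι → Type*} [MeasurableSpace Ω]
    [∀ i, MeasurableSpace (β i)] {μ : Measure Ω} {f : ∀ i, Ω → β i} {s : ∀ i, Set (β i)}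
    (h : iIndepFun f μ) (hf : ∀ i, Measurable (f i)) (hs : ∀ i, MeasurableSet (s i)) :
    iIndepSet (fun i => f i ⁻¹' s i) μ :=
  (iIndepSet_iff_meas_biInter fun i => hf i (hs i)).2 fun _ =>
    h.meas_biInter fun i _ => ⟨s i, hs i, rfl⟩

section

variable {ι κ β : Type*} [Finite ι] [Finite κ] [Finite β] [Nonempty β] [MeasurableSpace β]
  [MeasurableSingletonClass β]

theorem iIndepFun_apply_uniformOn_univ :
    iIndepFun (fun i (f : ι → β) => f i) (uniformOn Set.univ) := by
  have := Fintype.ofFinite ι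
  rw [← Set.pi_univ, uniformOn_pi]
  exact iIndepFun_pi (X := fun _ => id) fun _ => aemeasurable_id

theorem iIndepFun_apply_apply_uniformOn_univ :
    iIndepFun (fun (p : ι × κ) (f : ι → κ → β) => f p.1 p.2) (uniformOn Set.univ) := by
  have := Fintype.ofFinite ι
  have := Fintype.ofFinite κ
  rw [← Set.pi_univ, uniformOn_pi, ← Set.pi_univ, uniformOn_pi, ← Measure.infinitePi_eq_pi,
    ← Measure.infinitePi_eq_pi]
  exact iIndepFun_uncurry_infinitePi' (X := fun _ _ => id) _ fun _ _ => measurable_id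

theorem measurePreserving_apply_uniformOn_univ (i : ι) :
    MeasurePreserving (fun f : ι → β => f i) (uniformOn Set.univ) (uniformOn Set.univ) := by
  have := Fintype.ofFinite ι
  rw [← Set.pi_univ, uniformOn_pi]
  exact measurePreserving_eval _ i

end

theorem uniformOn_univ_real_apply_apply_mem {ι κ β : Type*} [Finite ι] [Finite κ] [Fintype β]
    [Nonempty β] [MeasurableSpace β] [MeasurableSingletonClass β] (i : ι) (j : κ) (A : Finset β) :
    (uniformOn Set.univ).real {f : ι → κ → β | f i j ∈ A} = #A / Fintype.card β := by
  have hpres := (measurePreserving_apply_uniformOn_univ (β := β) j).comp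
    (measurePreserving_apply_uniformOn_univ i)
  refine (hpres.measureReal_preimage A.measurableSet.nullMeasurableSet).trans ?_
  simp [measureReal_def, uniformOn_univ]

variable {P : Params}

/-- The law of the targets: uniform and independent for all items. -/
noncomputable abbrev targetLaw (P : Params) : Measure (Fin P.B → Fin P.D → Fin P.B) :=
  uniformOn Set.univ

section

variable [NeZero P.B]

instance : IsProbabilityMeasure (targetLaw P) :=
  isProbabilityMeasure_uniformOn Set.finite_univ Set.univ_nonempty

theorem targetLaw_real_mem (b : Fin P.B) (i : Fin P.D) (A : Finset (Fin P.B)) :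
    (targetLaw P).real {T | T b i ∈ A} = #A / P.B := by
  simp [uniformOn_univ_real_apply_apply_mem]

theorem iIndepSet_targetLaw (A : Finset (Fin P.B)) :
    iIndepSet (fun p : Fin P.B × Fin P.D => {T | T p.1 p.2 ∈ A}) (targetLaw P) :=
  iIndepSet_preimage_of_iIndepFun iIndepFun_apply_apply_uniformOn_univ
    (fun _ => measurable_of_finite _) fun _ => A.measurableSet

theorem targetLaw_real_le_load_sub_le (A : Finset (Fin P.B)) {r : ℝ} (hr : 0 ≤ r) :
    (targetLaw P).real {T | r ≤ load T A - P.D * #A} ≤ exp (-2 * r ^ 2 / P.N) := by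
  have hB : (P.B : ℝ) ≠ 0 := NeZero.ne _
  have hload (T : Fin P.B → Fin P.D → Fin P.B) : (load T A - P.D * #A : ℝ) =
      ∑ p : Fin P.B × Fin P.D, ({T | T p.1 p.2 ∈ A}.indicator 1 T -
        (targetLaw P).real {T | T p.1 p.2 ∈ A}) := by
    simp only [targetLaw_real_mem, Finset.sum_sub_distrib, Set.indicator_apply, load,
      Set.mem_ofPred_eq, Pi.one_apply, Finset.sum_boole, Finset.sum_const, Finset.card_univ,
      Fintype.card_prod, Fintype.card_fin, nsmul_eq_mul, Nat.cast_mul]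
    field_simp
  simp only [hload]
  simpa using measureReal_le_sum_indicator_sub_le (fun _ => MeasurableSet.of_discrete)
    (iIndepSet_targetLaw A) hr

theorem mgf_card_targets_eq_sub_le_half {t : ℝ}
    (ht : (exp t - 1) * (P.D / P.B) ≤ t * P.C - log 2) (b j : Fin P.B) :
    mgf (fun T => (#{i | T b i = j} - P.C : ℝ)) (targetLaw P) t ≤ 1 / 2 := by
  have hindep := (iIndepSet_targetLaw (P := P) {j}).precomp (Prod.mk_right_injective b)
  have hsum : (fun T : Fin P.B → Fin P.D → Fin P.B => (#{i | T b i = j} : ℝ)) =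
      ∑ i : Fin P.D, {T : Fin P.B → Fin P.D → Fin P.B | T b i ∈ ({j} : Finset _)}.indicator 1 := by
    ext T
    simp [Set.indicator_apply]
  have hmean : ∑ i, (targetLaw P).real {T | T b i ∈ ({j} : Finset _)} = P.D / P.B := by
    simp only [targetLaw_real_mem, Finset.card_singleton, Finset.sum_const, Finset.card_univ,
      Fintype.card_fin, nsmul_eq_mul, Nat.cast_one, mul_one_div]
  calc mgf (fun T => (#{i | T b i = j} - P.C : ℝ)) (targetLaw P) t
      = mgf (fun T => (#{i | T b i = j} : ℝ)) (targetLaw P) t * exp (t * -P.C) := by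
        simp_rw [sub_eq_add_neg]
        exact mgf_add_const _
    _ ≤ exp ((exp t - 1) * (P.D / P.B)) * exp (t * -P.C) := by
        gcongr
        rw [hsum, ← hmean]
        exact mgf_sum_indicator_one_le (fun _ => MeasurableSet.of_discrete) hindep Finset.univ t
    _ ≤ exp (-log 2) := by
        rw [← exp_add]
        gcongr
        linarith
    _ = 1 / 2 := by simp [exp_neg, exp_log]

theorem targetLaw_real_le_backlog_le {t : ℝ} (ht₀ : 0 ≤ t)
    (ht : (exp t - 1) * (P.D / P.B) ≤ t * P.C - log 2) (j : Fin P.B) (r : ℝ) {k : ℕ}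
    (hk : k ≤ P.B) :
    (targetLaw P).real {T | r ≤ backlog P.C (fun c => #{i | T c i = j}) k} ≤
      exp (t * (2 * P.C - r)) := by
  have hrows : iIndepFun (fun c (T : Fin P.B → Fin P.D → Fin P.B) => #{i | T c i = j})
      (targetLaw P) :=
    iIndepFun_apply_uniformOn_univ.comp (fun _ (f : Fin P.D → Fin P.B) => #{i | f i = j})
      fun _ => measurable_of_finite _
  have hmgf := mgf_backlog_le (fun _ => measurable_of_finite _) hrows (C := P.C) (t := t)
    (fun _ => .of_finite) one_half_pos.le one_half_lt_one
    (fun c => mgf_card_targets_eq_sub_le_half ht c j) hk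
  have hpos : 0 ≤ (exp t - 1) * (P.D / P.B : ℝ) :=
    mul_nonneg (sub_nonneg.2 (one_le_exp ht₀)) (by positivity)
  calc (targetLaw P).real {T | r ≤ backlog P.C (fun c => #{i | T c i = j}) k}
      ≤ exp (-t * r) *
          mgf (fun T => (backlog P.C (fun c => #{i | T c i = j}) k : ℝ)) (targetLaw P) t :=
        measure_ge_le_exp_mul_mgf r ht₀ .of_finite
    _ ≤ exp (-t * r) * exp (log 2) := by
        gcongr
        rw [exp_log two_pos]
        exact hmgf.trans_eq (by norm_num)
    _ ≤ exp (t * (2 * P.C - r)) := by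
        rw [← exp_add]
        gcongr
        linarith [log_nonneg one_le_two]

end

end UniformTargets

section FailureProbability

open MeasureTheory ProbabilityTheory Real

variable {P : Params}

theorem outputDist_none_toReal_le {α : Type*} (input : Fin P.N → α) :
    (outputDist P input none).toReal ≤
      (targetLaw P).real {T | ∃ σ, run P (T, σ) input = none} := by
  classical
  let bad : Finset (Fin P.B → Fin P.D → Fin P.B) := {T | ∃ σ, run P (T, σ) input = none}
  have hbad : (#{ω | run P ω input = none} : ℝ) ≤
      #bad * Fintype.card (Fin P.B → Equiv.Perm (Fin P.slots)) := by
    have hsub : ({ω | run P ω input = none} : Finset (Coins P)) ⊆ bad ×ˢ Finset.univ :=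
      fun ω hω => by simpa [bad] using ⟨ω.2, by simpa using hω⟩
    exact_mod_cast (Finset.card_le_card hsub).trans_eq (Finset.card_product _ _)
  have hlaw : (targetLaw P).real {T | ∃ σ, run P (T, σ) input = none} =
      #bad / Fintype.card (Fin P.B → Fin P.D → Fin P.B) := by
    rw [show {T | ∃ σ, run P (T, σ) input = none} = (bad : Set _) by simp [bad], measureReal_def,
      uniformOn_univ, Measure.count_apply_finset, ENNReal.toReal_div, ENNReal.toReal_natCast,
      ENNReal.toReal_natCast]
  rw [outputDist, map_uniformOfFintype_apply, hlaw, ENNReal.toReal_div, ENNReal.toReal_natCast,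
    ENNReal.toReal_natCast, Fintype.card_prod, Nat.cast_mul]
  refine (div_le_div_of_nonneg_right hbad (by positivity)).trans_eq ?_
  exact mul_div_mul_right _ _ (Nat.cast_ne_zero.2 Fintype.card_ne_zero)

theorem setOf_run_eq_none_subset {α : Type*} (hK : (P.S : ℝ) / P.B ≤ P.K)
    (input : Fin P.N → α) :
    {T | ∃ σ, run P (T, σ) input = none} ⊆
      (⋃ j : Fin P.B, ⋃ b : Fin P.B,
        {T | (P.S / P.B : ℝ) ≤ backlog P.C (fun c => #{i | T c i = j}) (b + 1)}) ∪
      ⋃ b : Fin P.B,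
        ({T | (P.D * P.W : ℝ) ≤ load T (Finset.Iic b)ᶜ - P.D * #(Finset.Iic b)ᶜ} ∪
          {T | (P.Q : ℝ) ≤ load T (Finset.Iic b) - P.D * #(Finset.Iic b)}) := by
  rintro T ⟨σ, hσ⟩
  contrapose! hσ
  simp only [Set.mem_union, Set.mem_iUnion, Set.mem_ofPred_eq, not_or, not_exists, not_le] at hσ
  obtain ⟨hstash, hload⟩ := hσ
  have hlow (b : Fin P.B) : P.D * (b + 1) ≤ load T (Finset.Iic b) + P.D * P.W := by
    have hcompl : (load T (Finset.Iic b) + load T (Finset.Iic b)ᶜ : ℝ) = P.B * P.D := by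
      exact_mod_cast load_add_load_compl T (Finset.Iic b)
    have hcard : (#(Finset.Iic b) + #(Finset.Iic b)ᶜ : ℝ) = P.B := by
      exact_mod_cast (Finset.card_add_card_compl (Finset.Iic b)).trans (Fintype.card_fin _)
    have hIic : (#(Finset.Iic b) : ℝ) = b + 1 := by simp
    have h := (hload b).1
    suffices (P.D * (b + 1) : ℝ) ≤ load T (Finset.Iic b) + P.D * P.W by exact_mod_cast this
    rw [← hIic]
    rw [← hcard] at hcompl
    linarith
  have hup (b : Fin P.B) : load T (Finset.Iic b) ≤ P.D * (b + 1) + P.Q := by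
    have h := (hload b).2
    rw [Fin.card_Iic, Nat.cast_add_one] at h
    suffices (load T (Finset.Iic b) : ℝ) ≤ P.D * (b + 1) + P.Q by exact_mod_cast this
    linarith
  obtain ⟨l, hl⟩ := exists_run_eq_some (ω := (T, σ)) (input := input) hK hstash hlow hup
  simp [hl]

theorem outputDist_none_toReal_le_of_nonneg {α : Type*} (hB : 0 < P.B) (hD : 0 < P.D)
    (hK : (P.S : ℝ) / P.B ≤ P.K) {t : ℝ} (ht : 0 ≤ t)
    (hexp : exp t < 1 + (t * P.C - log 2) * P.B / P.D) (input : Fin P.N → α) :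
    (outputDist P input none).toReal ≤
      P.B ^ 2 * exp (t * (2 * P.C - P.S / P.B)) +
        P.B * (exp (-2 * (P.D * P.W : ℝ) ^ 2 / P.N) + exp (-2 * (P.Q : ℝ) ^ 2 / P.N)) := by
  have : NeZero P.B := ⟨hB.ne'⟩
  have hrate : (exp t - 1) * (P.D / P.B) ≤ t * P.C - log 2 := by
    have hB' : (0 : ℝ) < P.B := Nat.cast_pos.2 hB
    have hD' : (0 : ℝ) < P.D := Nat.cast_pos.2 hD
    rw [← mul_div_assoc, div_le_iff₀ hB', ← le_div_iff₀ hD']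
    linarith
  refine (outputDist_none_toReal_le input).trans <|
    (measureReal_mono (setOf_run_eq_none_subset hK input)).trans <|
    (measureReal_union_le _ _).trans (add_le_add ?_ ?_)
  · refine (measureReal_iUnion_fintype_le _).trans <|
      (Finset.sum_le_sum fun j _ => measureReal_iUnion_fintype_le _).trans <|
      (Finset.sum_le_sum fun j _ => Finset.sum_le_sum fun b _ =>
        targetLaw_real_le_backlog_le ht hrate j _ (Nat.succ_le_of_lt b.isLt)).trans_eq ?_
    simp [sq, mul_assoc]
  · refine (measureReal_iUnion_fintype_le _).trans <|
      (Finset.sum_le_sum fun b _ => (measureReal_union_le _ _).trans (add_le_add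
        (targetLaw_real_le_load_sub_le _ (by positivity))
        (targetLaw_real_le_load_sub_le _ (by positivity)))).trans_eq ?_
    simp [mul_add]

end FailureProbability

end StashShuffle

theorem mainTheorem1_general (P : StashShuffle.Params) (hB : 0 < P.B) (hD : 0 < P.D)
    (hK : (P.S : ℝ) / P.B ≤ P.K) (hS : 2 * (P.C : ℝ) < P.S / P.B) (t : ℝ)
    (hexp : Real.exp t < 1 + (t * P.C - Real.log 2) * P.B / P.D)
    (input : Equiv.Perm (Fin P.N)) :
    StashShuffle.statDist (StashShuffle.outputDist P input) (StashShuffle.uniformDist P.N) ≤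
      (P.B : ℝ) ^ 2 * Real.exp (t * (2 * (P.C : ℝ) - (P.S : ℝ) / P.B)) +
        (P.B : ℝ) *
          (Real.exp (-2 * ((P.D : ℝ) * P.W) ^ 2 / (P.N : ℝ)) +
            Real.exp (-2 * (P.Q : ℝ) ^ 2 / (P.N : ℝ))) := by
  refine (StashShuffle.statDist_le_outputDist_none P input).trans ?_
  rcases le_or_gt 0 t with ht | ht
  · exact StashShuffle.outputDist_none_toReal_le_of_nonneg hB hD hK ht hexp input
  · have htotal : (StashShuffle.outputDist P input none).toReal ≤ 1 :=
      ENNReal.toReal_le_of_le_ofReal zero_le_one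
        ((PMF.coe_le_one _ _).trans_eq ENNReal.ofReal_one.symm)
    have htrivial : 1 ≤ (P.B : ℝ) ^ 2 * Real.exp (t * (2 * (P.C : ℝ) - P.S / P.B)) :=
      one_le_mul_of_one_le_of_one_le (one_le_pow₀ (Nat.one_le_cast.2 hB))
        (Real.one_le_exp (mul_nonneg_of_nonpos_of_nonpos ht.le (sub_nonpos.2 hS.le)))
    exact (htotal.trans htrivial).trans (le_add_of_nonneg_right (by positivity))

theorem mainTheorem1 (P : StashShuffle.Params) (hB : 0 < P.B) (hD : 0 < P.D)
    (hK : (P.S : ℝ) / P.B ≤ P.K) (hS : 2 * (P.C : ℝ) < P.S / P.B) (hW : P.W ≤ P.B)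
    (t : ℝ) (ht : t = (P.C : ℝ) * P.B / P.D - 1)
    (hexp : Real.exp t < 1 + (t * P.C - Real.log 2) * P.B / P.D)
    (input : Equiv.Perm (Fin P.N)) :
    StashShuffle.statDist (StashShuffle.outputDist P input) (StashShuffle.uniformDist P.N) ≤
      (P.B : ℝ) ^ 2 *
          Real.exp (((P.C : ℝ) * P.B / P.D - 1) * (2 * (P.C : ℝ) - (P.S : ℝ) / P.B)) +
        (P.B : ℝ) *
          (Real.exp (-2 * ((P.D : ℝ) * P.W) ^ 2 / (P.N : ℝ)) +
            Real.exp (-2 * (P.Q : ℝ) ^ 2 / (P.N : ℝ))) := by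
  subst ht
  exact mainTheorem1_general P hB hD hK hS _ hexp input
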